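/- **Setting.** A (hierarchically well separated) HST $T$ of depth $h$ with parameter $2$ is a rooted tree all of whose leaves lie on level $0$ and whose root is the only vertex on level $h$, the parent of a vertex on level $k$ being on level $k+1$ and joined to it by an edge of length $2^{k}$; $d_T$ denotes the weighted tree distance. A request set $R$ consists of finitely many requests $r_i=(v_i,t_i)$, $0\le i<|R|$, where $v_i$ is a vertex of $T$ and $t_i\ge 0$ is the issue time; $r_0=(v_0,0)$ is a dummy request (the initial tail of the queue), which every queueing order must put first. A queueing order is a permutation $\pi$ of $\{0,\dots,|R|-1\}$ with $\pi(0)=0$, where $r_{\pi(i)}$ is the request at position $i$. *Cost.* In an execution with queueing order $\pi$ of a distributed queueing algorithm $\mathsf{ALG}$, let $t_{\mathsf{ALG}}(i)\ge t_{\pi(i)}$ be the time at which node $v_{\pi(i-1)}$ is informed about the request $r_{\pi(i)}$, $1\le i<|R|$. The latency of $r_{\pi(i)}$ is $L_{\mathsf{ALG}}(i)=\max\{t_{\mathsf{ALG}}(i),t_{\pi(i-1)}\}-t_{\pi(i)}$, and the total latency cost is $\sum_{i=1}^{|R|-1}L_{\mathsf{ALG}}(i)$. The optimal offline cost on $T$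 is $$\mathrm{OPT}^T(R)=\min_{\pi}\ \sum_{i=1}^{|R|-1}\max\{d_T(v_{\pi(i-1)},v_{\pi(i)}),\,t_{\pi(i-1)}-t_{\pi(i)}\},$$ the minimum being over all queueing orders. *Properties.* $R$ is *condensed* if for any two requests $r_i,r_j$ that are consecutive with respect to time of occurrence ($t_i\le t_j$) there are requests $r_a,r_b$ in $R$ with $t_a\le t_i$, $t_b\ge t_j$ and $d_T(v_a,v_b)\ge t_b-t_a$. A queueing order $\pi$ is *distance-respecting* if $t_{\pi(i)}-t_{\pi(j)}\le d_T(v_{\pi(i)},v_{\pi(j)})$ whenever $i<j$. $\mathsf{ALG}$ has *distance-respecting latency cost* if for every request set and every possible execution, with order $\pi$, and all $1\le i\le j<|R|$, $$t_{\pi(i)}+L_{\mathsf{ALG}}(i)\le t_{\pi(j)}+d_T(v_{\pi(j)},v_{\pi(i-1)}).$$ **Theorem.** There is an absolute constant $C>0$ such that the following holds. Let $T$ be an HST (with parameter $2$), and let $\mathsf{ALG}$ be a distributed queueing algorithm that has distance-respecting latency cost and always produces a distance-respecting queueing order. Then for every condensed request set $R$ all of whose requests (including the dummy request) are issued at leaves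 of $T$, the total latency cost of every execution of $\mathsf{ALG}$ on $R$ is at most $C\cdot \mathrm{OPT}^T(R)$. -/

import Mathlib

open Finset

noncomputable section

/-- A hierarchically well separated tree with parameter `2` on the vertex set `V`, given as a rooted
tree by parent pointers.  The root is the unique vertex on level `depth`, the parent of a vertex
lies one level higher, and all leaves lie on level `0`.  The edge between a vertex on level `k` and
its parent has length `2 ^ k`; in particular the children of the root are at distance
`2 ^ (depth - 1)` from the root. -/
structure HST (V : Type*) where
  depth : ℕ
  root : V
  level : V → ℕ
  parent : V → V
  level_le_depth : ∀ v, level v ≤ depth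
  level_eq_depth_iff : ∀ v, level v = depth ↔ v = root
  level_parent : ∀ v, v ≠ root → level (parent v) = level v + 1
  /-- Only a convention: the root has no parent. -/
  parent_root : parent root = root
  /-- A vertex above level `0` has a child, so that the leaves are the vertices on level `0`. -/
  exists_child : ∀ v, 0 < level v → ∃ u, u ≠ root ∧ parent u = v

namespace HST

variable {V : Type*} (T : HST V)

/-- The vertex on level `m` on the path from `v` to the root (for `level v ≤ m ≤ depth`). -/
def ancestorAt (v : V) (m : ℕ) : V := T.parent^[m - T.level v] v

theorem ancestorAt_depth (v : V) : T.ancestorAt v T.depth = T.root := by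
  have key : ∀ (k : ℕ) (w : V), T.level w + k = T.depth → T.parent^[k] w = T.root := by
    intro k
    induction k with
    | zero => intro w hw; exact (T.level_eq_depth_iff w).1 (by simpa using hw)
    | succ k ih =>
      intro w hw
      have hne : w ≠ T.root := by
        intro h
        have := (T.level_eq_depth_iff w).2 h
        omega
      rw [Function.iterate_succ_apply]
      exact ih _ (by rw [T.level_parent w hne]; omega)
  exact key _ v (by have := T.level_le_depth v; omega)

/-- The levels on which the two paths from `u` and from `v` to the root have met. -/
def commonLevels (u v : V) : Set ℕ :=
  {m | T.level u ≤ m ∧ T.level v ≤ m ∧ T.ancestorAt u m = T.ancestorAt v m}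

theorem commonLevels_nonempty (u v : V) : (T.commonLevels u v).Nonempty :=
  ⟨T.depth, T.level_le_depth u, T.level_le_depth v, by simp [ancestorAt_depth]⟩

/-- The level of the least common ancestor of `u` and `v`. -/
def lcaLevel (u v : V) : ℕ := sInf (T.commonLevels u v)

/-- The weighted distance `d_T(u,v)`: the total edge length of the path from `u` up to
the least common ancestor of `u` and `v` and from there down to `v`. -/
def dist (u v : V) : ℝ :=
  ∑ k ∈ Finset.Ico (T.level u) (T.lcaLevel u v), (2 : ℝ) ^ k +
    ∑ k ∈ Finset.Ico (T.level v) (T.lcaLevel u v), (2 : ℝ) ^ k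

/-- Leaves are the vertices on level `0`. -/
def IsLeaf (v : V) : Prop := T.level v = 0

end HST

/-- A finite set of queueing requests `r_i = (node i, time i)`, `0 ≤ i ≤ n`, issued at vertices.
Request `0` is the dummy request that describes the initial tail of the queue. -/
structure RequestSet (V : Type*) where
  n : ℕ
  node : Fin (n + 1) → V
  time : Fin (n + 1) → ℝ
  time_zero : time 0 = 0
  time_nonneg : ∀ i, 0 ≤ time i

namespace RequestSet

variable {V : Type*} (R : RequestSet V)

/-- All requests (the dummy request included) are issued at leaves of `T`. -/
def AtLeaves (T : HST V) : Prop := ∀ i, T.IsLeaf (R.node i)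

/-- `r_i` and `r_j` are consecutive with respect to the time of occurrence. -/
def Consecutive (i j : Fin (R.n + 1)) : Prop :=
  R.time i ≤ R.time j ∧ ∀ k, ¬ (R.time i < R.time k ∧ R.time k < R.time j)

/-- Condensed request sets. -/
def Condensed (T : HST V) : Prop :=
  ∀ i j, R.Consecutive i j →
    ∃ a b, R.time a ≤ R.time i ∧ R.time j ≤ R.time b ∧
      R.time b - R.time a ≤ T.dist (R.node a) (R.node b)

/-- Queueing orders: `π k` is the index of the request at position `k`; the dummy request has to be
ordered first. -/
def orders : Finset (Equiv.Perm (Fin (R.n + 1))) := Finset.univ.filter fun π => π 0 = 0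

theorem orders_nonempty : R.orders.Nonempty := ⟨1, by simp [orders]⟩

/-- The latency of an offline algorithm on `T` for ordering `r_j` directly after `r_i`. -/
def offlineLatency (T : HST V) (i j : Fin (R.n + 1)) : ℝ :=
  max (T.dist (R.node i) (R.node j)) (R.time i - R.time j)

/-- The total offline cost of a queueing order. -/
def offlineCost (T : HST V) (π : Equiv.Perm (Fin (R.n + 1))) : ℝ :=
  ∑ i : Fin R.n, R.offlineLatency T (π i.castSucc) (π i.succ)

/-- The optimal offline cost on `T`. -/
def optCost (T : HST V) : ℝ := R.orders.inf' R.orders_nonempty (R.offlineCost T)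

end RequestSet

/-- What an execution of a queueing algorithm with request set `R` results in: the queueing order,
and for each `i : Fin n` the time `informTime i` at which the node of the request at position `i` is
informed about its successor, the request at position `i + 1`.  This cannot happen before the
latter is issued. -/
structure QueueingOutcome {V : Type*} (R : RequestSet V) where
  order : Equiv.Perm (Fin (R.n + 1))
  order_zero : order 0 = 0
  informTime : Fin R.n → ℝ
  issued_le_informTime : ∀ i, R.time (order i.succ) ≤ informTime i

namespace QueueingOutcome

variable {V : Type*} {R : RequestSet V} (E : QueueingOutcome R)

/-- The latency for enqueueing the request at position `i + 1` behind the one at position `i`: the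
time from its issue until its predecessor is in the system and has been informed. -/
def latency (i : Fin R.n) : ℝ :=
  max (E.informTime i) (R.time (E.order i.castSucc)) - R.time (E.order i.succ)

/-- The total latency cost. -/
def cost : ℝ := ∑ i : Fin R.n, E.latency i

/-- The queueing order is distance-respecting. -/
def DistanceRespectingOrder (T : HST V) : Prop :=
  ∀ i j : Fin (R.n + 1), i < j →
    R.time (E.order i) - R.time (E.order j) ≤ T.dist (R.node (E.order i)) (R.node (E.order j))

/-- The latency cost is distance-respecting: for positions `1 ≤ i + 1 ≤ j`, the request at
position `i + 1` is enqueued no later than a message sent by the request at position `j` at the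
time of its issue would reach, at full delay, the node of the request at position `i`. -/
def DistanceRespectingLatency (T : HST V) : Prop :=
  ∀ (i : Fin R.n) (j : Fin (R.n + 1)), i.succ ≤ j →
    R.time (E.order i.succ) + E.latency i ≤
      R.time (E.order j) + T.dist (R.node (E.order j)) (R.node (E.order i.castSucc))

end QueueingOutcome

/-- A queueing algorithm on the vertex set `V`, represented by the outcomes of its possible
executions on each request set.  There are several possible outcomes in general, because message
delays (and random choices) are not determined by the request set.  Every distributed online
algorithm gives such an object; no restriction on how the outcomes come about is imposed. -/
def QueueingAlgorithm (V : Type*) := (R : RequestSet V) → Set (QueueingOutcome R)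

namespace QueueingAlgorithm

variable {V : Type*} (A : QueueingAlgorithm V)

/-- The algorithm always produces a distance-respecting queueing order. -/
def ProducesDistanceRespectingOrders (T : HST V) : Prop :=
  ∀ R : RequestSet V, ∀ E ∈ A R, E.DistanceRespectingOrder T

/-- The algorithm has distance-respecting latency cost. -/
def HasDistanceRespectingLatency (T : HST V) : Prop :=
  ∀ R : RequestSet V, ∀ E ∈ A R, E.DistanceRespectingLatency T

end QueueingAlgorithm

end

/-! Number the requests along an optimal order `σ`, which becomes a path visiting all requests. On
leaves `T.dist` is an ultrametric.

Let `x i` be the latency of the request after position `i` plus the time increment to it. The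
increments telescope to a nonnegative number, so `∑ x` bounds the cost, and distance-respecting
latency bounds `x i` by (signed time difference plus distance) to every later request. Fix `r > 0`
and cut the path at its steps of Manhattan length at least `r`. Inside a block all distances are
below `r`, and times advance in jumps below `r`. Hence a position with `x i ≥ 3 * r` can have no
later position in its block, and there are at most as many such positions as cuts
(`card_greedy_le`). Integrating over `r` bounds `∑ x` by 3 times the Manhattan length of the path.

The offline cost pays for motion in space and backward motion in time. Forward motion equals
backward motion plus the net advance, and condensedness bounds that advance (`time_sub_le`). So the
Manhattan length is at most 6 times the offline cost, whence the constant 18. -/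

open MeasureTheory

/-! ### Leaves of an HST form an ultrametric space -/

namespace HST

variable {V : Type*} (T : HST V)

theorem mem_commonLevels_of_isLeaf {u v : V} (hu : T.IsLeaf u) (hv : T.IsLeaf v) (m : ℕ) :
    m ∈ T.commonLevels u v ↔ T.parent^[m] u = T.parent^[m] v := by
  unfold IsLeaf at hu hv
  simp [commonLevels, ancestorAt, hu, hv]

/-- Paths to the root stay together once they have met. The strong triangle inequality for
`lcaLevel` is then transitivity of equality. -/
theorem iterate_parent_eq_iff {u v : V} (hu : T.IsLeaf u) (hv : T.IsLeaf v) (m : ℕ) :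
    T.parent^[m] u = T.parent^[m] v ↔ T.lcaLevel u v ≤ m := by
  rw [← T.mem_commonLevels_of_isLeaf hu hv]
  refine ⟨fun h => Nat.sInf_le h, fun h => ?_⟩
  have h0 := Nat.sInf_mem (T.commonLevels_nonempty u v)
  rw [mem_commonLevels_of_isLeaf T hu hv] at h0 ⊢
  obtain ⟨k, rfl⟩ := Nat.exists_eq_add_of_le' h
  rw [Function.iterate_add_apply, Function.iterate_add_apply]
  exact congrArg _ h0

theorem dist_eq_of_isLeaf {u v : V} (hu : T.IsLeaf u) (hv : T.IsLeaf v) :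
    T.dist u v = 2 * ∑ k ∈ Finset.range (T.lcaLevel u v), (2 : ℝ) ^ k := by
  unfold IsLeaf at hu hv
  rw [dist, hu, hv, Finset.range_eq_Ico, two_mul]

theorem dist_nonneg (u v : V) : 0 ≤ T.dist u v := by
  unfold dist
  positivity

theorem dist_comm (u v : V) : T.dist u v = T.dist v u := by
  have h : T.commonLevels u v = T.commonLevels v u := by
    ext m
    simp only [commonLevels, Set.mem_ofPred_eq]
    tauto
  simp only [dist, lcaLevel, h]
  exact add_comm _ _

theorem dist_self_of_isLeaf {u : V} (hu : T.IsLeaf u) : T.dist u u = 0 := by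
  have h : T.lcaLevel u u = 0 := Nat.le_zero.1 ((T.iterate_parent_eq_iff hu hu 0).1 rfl)
  rw [T.dist_eq_of_isLeaf hu hu, h]
  simp

theorem dist_le_max_of_isLeaf {u v w : V} (hu : T.IsLeaf u) (hv : T.IsLeaf v) (hw : T.IsLeaf w) :
    T.dist u w ≤ max (T.dist u v) (T.dist v w) := by
  have mono : ∀ {a b : ℕ}, a ≤ b → 2 * ∑ k ∈ Finset.range a, (2 : ℝ) ^ k ≤
      2 * ∑ k ∈ Finset.range b, (2 : ℝ) ^ k := fun h => by
    gcongr
  have h : T.lcaLevel u w ≤ max (T.lcaLevel u v) (T.lcaLevel v w) := by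
    rw [← T.iterate_parent_eq_iff hu hw]
    exact ((T.iterate_parent_eq_iff hu hv _).2 (le_max_left _ _)).trans
      ((T.iterate_parent_eq_iff hv hw _).2 (le_max_right _ _))
  rw [T.dist_eq_of_isLeaf hu hw, T.dist_eq_of_isLeaf hu hv, T.dist_eq_of_isLeaf hv hw]
  rcases le_max_iff.1 h with h | h
  · exact le_max_of_le_left (mono h)
  · exact le_max_of_le_right (mono h)

end HST

/-! ### Telescoping and layer-cake comparison of sums -/

theorem Fin.sum_succ_sub_castSucc {n : ℕ} (f : Fin (n + 1) → ℝ) :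
    ∑ i : Fin n, (f i.succ - f i.castSucc) = f (Fin.last n) - f 0 := by
  have h := Fin.sum_univ_succ f
  rw [Fin.sum_univ_castSucc] at h
  rw [Finset.sum_sub_distrib]
  linarith

/-- Layer-cake formula; `ENNReal.ofReal` drops negative terms, so positive thresholds suffice. -/
theorem sum_ofReal_eq_lintegral_card {α : Type*} [Fintype α] (f : α → ℝ) :
    ∑ i, ENNReal.ofReal (f i) =
      ∫⁻ r in Set.Ioi (0 : ℝ), ((#{i | r ≤ f i} : ℕ) : ENNReal) := by
  have e : ∀ r : ℝ, ((#{i | r ≤ f i} : ℕ) : ENNReal) =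
      ∑ i, (Set.Iic (f i)).indicator (fun _ => (1 : ENNReal)) r := by
    intro r
    simp [Set.indicator_apply, Finset.sum_boole]
  simp_rw [e]
  rw [lintegral_finsetSum _ fun i _ => measurable_const.indicator measurableSet_Iic]
  refine Finset.sum_congr rfl fun i _ => ?_
  rw [lintegral_indicator measurableSet_Iic, Measure.restrict_restrict measurableSet_Iic,
    lintegral_one, Measure.restrict_apply_univ, Set.inter_comm, Set.Ioi_inter_Iic,
    Real.volume_Ioc, sub_zero]

/-- Comparing sums by comparing, for every threshold, the numbers of terms above it. -/
theorem sum_le_mul_sum_of_card_le {ι κ : Type*} [Fintype ι] [Fintype κ] (x : ι → ℝ) (m : κ → ℝ)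
    {c : ℝ} (hc : 0 < c) (hm : ∀ j, 0 ≤ m j)
    (h : ∀ r : ℝ, 0 < r → #{i | c * r ≤ x i} ≤ #{j | r ≤ m j}) :
    ∑ i, x i ≤ c * ∑ j, m j := by
  have h1 : ∑ i, ENNReal.ofReal (x i) ≤ ∑ j, ENNReal.ofReal (c * m j) := by
    rw [sum_ofReal_eq_lintegral_card, sum_ofReal_eq_lintegral_card]
    refine setLIntegral_mono' measurableSet_Ioi fun r hr => ?_
    have := h (r / c) (div_pos hr hc)
    rw [mul_div_cancel₀ _ hc.ne'] at this
    simp_rw [div_le_iff₀' hc] at this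
    exact_mod_cast this
  have hcm : ∀ j, 0 ≤ c * m j := fun j => mul_nonneg hc.le (hm j)
  rw [← ENNReal.ofReal_sum_of_nonneg fun j _ => hcm j, ← Finset.mul_sum] at h1
  have h2 : ENNReal.ofReal (∑ i, max (x i) 0) ≤ ENNReal.ofReal (c * ∑ j, m j) := by
    rw [ENNReal.ofReal_sum_of_nonneg fun i _ => le_max_right _ _]
    simpa [ENNReal.ofReal_max] using h1
  rw [ENNReal.ofReal_le_ofReal_iff (mul_nonneg hc.le (Finset.sum_nonneg fun j _ => hm j))] at h2
  exact (Finset.sum_le_sum fun i _ => le_max_left _ _).trans h2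

/-! ### Counting greedy costs against long steps -/

/-- A symmetric, nonnegative function that vanishes on the diagonal and satisfies the strong
triangle inequality. -/
structure IsUltra {α : Type*} (d : α → α → ℝ) : Prop where
  nonneg : ∀ a b, 0 ≤ d a b
  self : ∀ a, d a a = 0
  comm : ∀ a b, d a b = d b a
  le_max : ∀ a b c, d a c ≤ max (d a b) (d b c)

/-- Two requests whose Manhattan distance (space plus time) is less than `r`. -/
def ManhattanLT {α : Type*} (d : α → α → ℝ) (t : α → ℝ) (r : ℝ) (a b : α) : Prop :=
  d a b + |t a - t b| < r

open Relation

namespace IsUltra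

variable {α : Type*} {d : α → α → ℝ}

theorem triangle (hd : IsUltra d) (a b c : α) : d a c ≤ d a b + d b c :=
  (hd.le_max a b c).trans (max_le_add_of_nonneg (hd.nonneg _ _) (hd.nonneg _ _))

theorem symm_manhattanLT (hd : IsUltra d) (t : α → ℝ) (r : ℝ) :
    Std.Symm (ManhattanLT d t r) where
  symm a b h := by rwa [ManhattanLT, hd.comm, abs_sub_comm]

/-- By the strong triangle inequality the bound does not grow with the number of steps. -/
theorem dist_lt_of_reflTransGen (hd : IsUltra d) {t : α → ℝ} {r : ℝ} (hr : 0 < r) {a b : α}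
    (h : ReflTransGen (ManhattanLT d t r) a b) : d a b < r := by
  induction h with
  | refl => rwa [hd.self]
  | @tail b c _ hbc ih =>
    have h1 : d b c < r := lt_of_le_of_lt (le_add_of_nonneg_right (abs_nonneg _)) hbc
    exact (hd.le_max a b c).trans_lt (max_lt ih h1)

/-- A chain of short steps that ends later than `t a + r` visits the time window
`(t a + r, t a + 2 * r)`. -/
theorem exists_time_mem_window (hd : IsUltra d) {t : α → ℝ} {r : ℝ} (hr : 0 < r) {a b : α}
    (h : ReflTransGen (ManhattanLT d t r) a b) (hb : t a + r < t b) :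
    ∃ c, ReflTransGen (ManhattanLT d t r) a c ∧ t a + r < t c ∧ t c < t a + 2 * r := by
  induction h with
  | refl => linarith
  | @tail b c hab hbc ih =>
    by_cases hk : t a + r < t b
    · exact ih hk
    · have h1 : |t b - t c| < r := lt_of_le_of_lt (le_add_of_nonneg_left (hd.nonneg _ _)) hbc
      have := (abs_lt.1 h1).1
      exact ⟨c, hab.tail hbc, hb, by linarith⟩

/-- Greedy costs `x` of a distance-respecting order `π` against the Manhattan lengths of the steps
of a path visiting all requests: at most as many greedy costs are at least `3 * r` as there are
steps of length at least `r`. -/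
theorem card_greedy_le {n : ℕ} {d : Fin (n + 1) → Fin (n + 1) → ℝ} (hd : IsUltra d)
    (t : Fin (n + 1) → ℝ) (π : Equiv.Perm (Fin (n + 1)))
    (hπ : ∀ i j, i < j → t (π i) - t (π j) ≤ d (π i) (π j)) (x : Fin n → ℝ)
    (hx : ∀ (i : Fin n) j, i.castSucc < j → x i ≤ t (π j) - t (π i.castSucc) +
      d (π i.castSucc) (π j)) {r : ℝ} (hr : 0 < r) :
    #{i | 3 * r ≤ x i} ≤
      #{p : Fin n | r ≤ d p.castSucc p.succ + |t p.castSucc - t p.succ|} := by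
  set S : Finset (Fin n) := {i | 3 * r ≤ x i} with hS
  set L : Finset (Fin n) := {p | r ≤ d p.castSucc p.succ + |t p.castSucc - t p.succ|} with hL
  -- The number of long steps before `q` labels the block of `q`.
  let b : Fin (n + 1) → ℕ := fun q => #{p ∈ L | p.castSucc < q}
  have bmono : Monotone b := fun q q' h =>
    Finset.card_le_card fun p hp => by
      simp only [Finset.mem_filter] at hp ⊢
      exact ⟨hp.1, hp.2.trans_le h⟩
  have chain : ∀ q' q, q ≤ q' → b q = b q' → ReflTransGen (ManhattanLT d t r) q q' := by
    intro q'
    induction q' using Fin.induction with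
    | zero =>
      intro q hq _
      rw [Fin.le_zero_iff.1 hq]
    | succ k ih =>
      intro q hq hb
      rcases hq.eq_or_lt with rfl | hlt
      · exact .refl
      have hle : q ≤ k.castSucc := Fin.le_castSucc_iff.2 hlt
      have h1 := bmono hle
      have h2 : b k.castSucc ≤ b k.succ := bmono (Fin.castSucc_lt_succ (i := k)).le
      refine (ih q hle (by omega)).tail ?_
      by_contra hk
      have hkL : k ∈ L := by simpa [hL, ManhattanLT] using hk
      have h3 : b k.castSucc < b k.succ := by
        refine Finset.card_lt_card (Finset.ssubset_iff_of_subset ?_ |>.2 ⟨k, ?_, ?_⟩)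
        · intro p hp
          simp only [Finset.mem_filter] at hp ⊢
          exact ⟨hp.1, hp.2.trans Fin.castSucc_lt_succ⟩
        · simp [hkL]
        · simp
      omega
  have chain' : ∀ q q', b q = b q' → ReflTransGen (ManhattanLT d t r) q q' := fun q q' hb => by
    rcases le_total q q' with h | h
    · exact chain _ _ h hb
    · have := hd.symm_manhattanLT t r
      exact ReflTransGen.stdSymm.symm _ _ (chain _ _ h hb.symm)
  -- A later `π j` in the block would lie more than `2 * r` later in time, so the chain to it meets
  -- the window at some `π k`. If `k` precedes `i`, the order is not distance-respecting; if it
  -- follows, `x i < 2 * r + r`.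
  have sep : ∀ i ∈ S, ∀ j, i.castSucc < j → b (π i.castSucc) ≠ b (π j) := by
    intro i hi j hij hb
    have hi : 3 * r ≤ x i := by simpa [hS] using hi
    have hch := chain' _ _ hb
    have h1 := hd.dist_lt_of_reflTransGen hr hch
    have h2 := hx i j hij
    obtain ⟨c, hc, hc1, hc2⟩ := hd.exists_time_mem_window hr hch (by linarith)
    have h3 := hd.dist_lt_of_reflTransGen hr hc
    obtain ⟨k, rfl⟩ := π.surjective c
    rcases lt_trichotomy k i.castSucc with hk | rfl | hk
    · have := hπ _ _ hk
      rw [hd.comm] at this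
      linarith
    · linarith
    · have := hx i k hk
      linarith
  -- Nothing follows the last position, so it can be added; it offsets the extra block in `#L + 1`.
  let S' : Finset (Fin (n + 1)) := insert (Fin.last n) (S.map Fin.castSuccEmb)
  have hS' : ∀ i ∈ S', ∀ j, i < j → ∃ k ∈ S, k.castSucc = i := by
    intro i hi j hij
    rcases Finset.mem_insert.1 hi with rfl | hi
    · exact absurd (Fin.le_last j) (not_le.2 hij)
    · simpa using hi
  have hcard : #S' = #S + 1 := by
    rw [Finset.card_insert_of_notMem, Finset.card_map]
    simp [(Fin.castSucc_lt_last _).ne]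
  have hinj : Set.InjOn (fun i => b (π i)) S' := by
    intro i hi j hj hij
    by_contra hne
    rcases lt_or_gt_of_ne hne with h | h
    · obtain ⟨k, hk, rfl⟩ := hS' i hi j h
      exact sep k hk j h hij
    · obtain ⟨k, hk, rfl⟩ := hS' j hj i h
      exact sep k hk i h hij.symm
  have hmaps : ∀ i ∈ S', b (π i) ∈ Finset.range (#L + 1) := fun i _ =>
    Finset.mem_range.2 (Nat.lt_succ_of_le (Finset.card_le_card (Finset.filter_subset _ _)))
  have := Finset.card_le_card_of_injOn _ hmaps hinj
  rw [hcard, Finset.card_range] at this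
  omega

/-! ### Time span and Manhattan length in condensed sets -/

theorem dist_le_sum_steps {n : ℕ} {d : Fin (n + 1) → Fin (n + 1) → ℝ} (hd : IsUltra d)
    {a b : Fin (n + 1)} (hab : a ≤ b) :
    d a b ≤ ∑ p : Fin n with p.castSucc < b, d p.castSucc p.succ -
      ∑ p : Fin n with p.castSucc < a, d p.castSucc p.succ := by
  induction b using Fin.induction with
  | zero =>
    rw [Fin.le_zero_iff.1 hab, hd.self, sub_self]
  | succ k ih =>
    rcases hab.eq_or_lt with rfl | hlt
    · rw [hd.self, sub_self]
    have h1 := ih (Fin.le_castSucc_iff.2 hlt)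
    have h2 : ∑ p : Fin n with p.castSucc < k.succ, d p.castSucc p.succ =
        d k.castSucc k.succ + ∑ p : Fin n with p.castSucc < k.castSucc, d p.castSucc p.succ := by
      have h3 : ({p | p.castSucc < k.succ} : Finset (Fin n)) =
          insert k ({p | p.castSucc < k.castSucc} : Finset (Fin n)) := by
        ext p
        simp [le_iff_eq_or_lt]
      rw [h3, Finset.sum_insert (by simp)]
    have h3 := hd.triangle a k.castSucc k.succ
    linarith

/-- In a condensed request set the time span is bounded by the backward motion in time plus twice
the motion in space of a path that visits all requests. -/
theorem time_sub_le {n : ℕ} {d : Fin (n + 1) → Fin (n + 1) → ℝ} (hd : IsUltra d)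
    (t : Fin (n + 1) → ℝ) (ht : ∀ i, t 0 ≤ t i)
    (hcond : ∀ i j, t i ≤ t j → (∀ k, ¬ (t i < t k ∧ t k < t j)) →
      ∃ a b, t a ≤ t i ∧ t j ≤ t b ∧ t b - t a ≤ d a b) (k : Fin (n + 1)) :
    t k - t 0 ≤ ∑ p : Fin n, max (t p.castSucc - t p.succ) 0 +
      2 * ∑ p : Fin n, d p.castSucc p.succ := by
  set tot := ∑ p : Fin n, d p.castSucc p.succ
  let D : Fin (n + 1) → ℝ := fun q => ∑ p : Fin n with p.castSucc < q, d p.castSucc p.succ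
  have hDle : ∀ q, D q ≤ tot := fun q =>
    Finset.sum_le_sum_of_subset_of_nonneg (Finset.filter_subset _ _) fun _ _ _ => hd.nonneg _ _
  have hdD : ∀ {a b}, a ≤ b → d a b ≤ D b - D a := fun h => hd.dist_le_sum_steps h
  have hDmono : Monotone D := fun a b h => by
    have := hdD h
    linarith [hd.nonneg a b]
  have hD0 : D 0 = 0 := by simp [D]
  -- Backward motion of the path above time level `τ`.
  let B : ℝ → ℝ := fun τ => ∑ p : Fin n, max (max (t p.castSucc) τ - max (t p.succ) τ) 0
  have term_anti : ∀ (u v : ℝ) {τ τ' : ℝ}, τ ≤ τ' →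
      max (max u τ' - max v τ') 0 ≤ max (max u τ - max v τ) 0 := by
    intro u v τ τ' h
    refine max_le ?_ (le_max_right _ _)
    rcases le_total u v with huv | huv
    · exact le_max_of_le_right (sub_nonpos.2 (max_le_max huv le_rfl))
    · refine le_max_of_le_left ?_
      rcases max_cases u τ with h1 | h1 <;> rcases max_cases v τ with h2 | h2 <;>
      rcases max_cases u τ' with h3 | h3 <;> rcases max_cases v τ' with h4 | h4 <;>
      linarith
  have hBanti : ∀ {τ τ'}, τ ≤ τ' → B τ' ≤ B τ := fun h =>
    Finset.sum_le_sum fun p _ => term_anti _ _ h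
  have hBnn : ∀ τ, 0 ≤ B τ := fun τ => Finset.sum_nonneg fun _ _ => le_max_right _ _
  -- Sweep upwards in time from `t c`. Measured by `D`, the path may be charged twice: the remaining
  -- budget is `(tot - y) + (tot - D q)`. The hypothesis on `y` says that pairs reaching beyond `t
  -- c` start at or after `y`.
  have main : ∀ (N : ℕ) (c q : Fin (n + 1)) (y : ℝ), #{e | t c < t e} ≤ N → t q ≤ t c → y ≤ tot →
      (∀ a b, t b - t a ≤ d a b → t c < t b → y ≤ D a) →
      t k - t c ≤ B (t c) + 2 * tot - y - D q := by
    intro N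
    induction N with
    | zero =>
      intro c q y hN _ hy _
      have hk : ¬ t c < t k := fun h => by
        have : k ∈ ({e | t c < t e} : Finset (Fin (n + 1))) := by simpa using h
        rw [Finset.card_eq_zero.1 (Nat.le_zero.1 hN)] at this
        simp at this
      linarith [hBnn (t c), hDle q]
    | succ N ih =>
      intro c q y hN hq hy hay
      by_cases hk : t c < t k
      swap
      · linarith [hBnn (t c), hDle q]
      have card_lt : ∀ e, t c < t e → #{f | t e < t f} ≤ N := by
        intro e he
        refine Nat.le_of_lt_succ (lt_of_lt_of_le (Finset.card_lt_card ?_) hN)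
        refine Finset.ssubset_iff_of_subset ?_ |>.2 ⟨e, by simpa using he, by simp⟩
        intro f hf
        simp only [Finset.mem_filter, Finset.mem_univ, true_and] at hf ⊢
        exact he.trans hf
      obtain ⟨e, he, hemin⟩ := Finset.exists_min_image ({e | t c < t e} : Finset (Fin (n + 1))) t
        ⟨k, by simpa using hk⟩
      simp only [Finset.mem_filter, Finset.mem_univ, true_and] at he hemin
      -- A backward step across level `t c` pays for the gap up to the next time `t e`.
      by_cases hback : ∃ p : Fin n, t c < t p.castSucc ∧ t p.succ ≤ t c
      · obtain ⟨p, hp1, hp2⟩ := hback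
        have h1 := ih e q y (card_lt e he) (hq.trans he.le) hy
          fun a b hab hb => hay a b hab (he.trans hb)
        have h2 : B (t e) + (t e - t c) ≤ B (t c) := by
          have : t e - t c ≤ B (t c) - B (t e) := by
            simp only [B]
            rw [← Finset.sum_sub_distrib]
            refine le_trans ?_ (Finset.single_le_sum
              (fun i _ => sub_nonneg.2 (term_anti _ _ he.le)) (Finset.mem_univ p))
            rw [max_eq_left hp1.le, max_eq_right hp2, max_eq_left (hemin _ hp1),
              max_eq_right (hp2.trans he.le), max_eq_left (sub_nonneg.2 hp1.le),
              max_eq_left (sub_nonneg.2 (hemin _ hp1))]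
            linarith
          linarith
        linarith
      -- Otherwise the path never returns to times `≤ t c`, so all requests up to `t c` precede all
      -- later ones on it.
      · push Not at hback
        have stay : ∀ w v, v ≤ w → t c < t v → t c < t w := by
          intro w
          induction w using Fin.induction with
          | zero => intro v hv h; rwa [← Fin.le_zero_iff.1 hv]
          | succ w ihw =>
            intro v hv h
            rcases hv.eq_or_lt with rfl | hlt
            · exact h
            · exact hback w (ihw v (Fin.le_castSucc_iff.2 hlt) h)
        have cross : ∀ u v, t u ≤ t c → t c < t v → u ≤ v := fun u v hu hv =>
          le_of_not_ge fun h => absurd (stay u v h hv) (not_lt.2 hu)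
        obtain ⟨a₀, b₀, ha₀, hb₀, hab₀⟩ := hcond c e he.le
          fun f hf => absurd (hemin f hf.1) (not_le.2 hf.2)
        -- The pair reaching furthest in time advances the sweep to `t b`, at a charge of `D b - D a
        -- ≤ D b - y`.
        obtain ⟨⟨a, b⟩, hmem, hmax⟩ := Finset.exists_max_image
          ({z | t z.1 ≤ t c ∧ t c < t z.2 ∧ t z.2 - t z.1 ≤ d z.1 z.2} :
            Finset (Fin (n + 1) × Fin (n + 1))) (fun z => t z.2)
          ⟨(a₀, b₀), by simpa only [Finset.mem_filter, Finset.mem_univ, true_and] using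
            ⟨ha₀, he.trans_le hb₀, hab₀⟩⟩
        simp only [Finset.mem_filter, Finset.mem_univ, true_and] at hmem hmax
        obtain ⟨ha, hb, hab⟩ := hmem
        -- By maximality a pair reaching beyond `t b` starts after `t c`, hence at or after `q` on
        -- the path. So the new `y` is `D q`, and no part is charged three times.
        have h1 := ih b b (D q) (card_lt b hb) le_rfl (hDle q) fun a' b' hab' hb' => by
          refine hDmono (cross q a' hq (lt_of_not_ge fun h => ?_))
          exact absurd (hmax (a', b') ⟨h, hb.trans hb', hab'⟩) (not_le.2 hb')
        have h2 := hdD (cross a b ha hb)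
        have h3 := hay a b hab hb
        have h4 := hBanti hb.le
        linarith
  have h := main _ 0 0 0 le_rfl le_rfl
    (Finset.sum_nonneg fun _ _ => hd.nonneg _ _) fun a _ _ _ => by
      rw [← hD0]
      exact hDmono (Fin.zero_le a)
  have hB0 : B (t 0) = ∑ p : Fin n, max (t p.castSucc - t p.succ) 0 := by
    simp only [B]
    exact Finset.sum_congr rfl fun p _ => by rw [max_eq_left (ht _), max_eq_left (ht _)]
  rw [hB0, hD0] at h
  linarith

/-- The Manhattan length of a path through a condensed request set, bounded by its offline
latency cost. -/
theorem sum_manhattan_le {n : ℕ} {d : Fin (n + 1) → Fin (n + 1) → ℝ} (hd : IsUltra d)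
    (t : Fin (n + 1) → ℝ) (ht : ∀ i, t 0 ≤ t i)
    (hcond : ∀ i j, t i ≤ t j → (∀ k, ¬ (t i < t k ∧ t k < t j)) →
      ∃ a b, t a ≤ t i ∧ t j ≤ t b ∧ t b - t a ≤ d a b) :
    ∑ p : Fin n, (d p.castSucc p.succ + |t p.castSucc - t p.succ|) ≤
      6 * ∑ p : Fin n, max (d p.castSucc p.succ) (t p.castSucc - t p.succ) := by
  have h1 := hd.time_sub_le t ht hcond (Fin.last n)
  have h2 : ∑ p : Fin n, d p.castSucc p.succ ≤
      ∑ p : Fin n, max (d p.castSucc p.succ) (t p.castSucc - t p.succ) :=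
    Finset.sum_le_sum fun _ _ => le_max_left _ _
  have h3 : ∑ p : Fin n, max (t p.castSucc - t p.succ) 0 ≤
      ∑ p : Fin n, max (d p.castSucc p.succ) (t p.castSucc - t p.succ) :=
    Finset.sum_le_sum fun _ _ => max_le (le_max_right _ _) (le_max_of_le_left (hd.nonneg _ _))
  -- `|u| = 2 * max u 0 - u`, and the last term telescopes.
  have h4 : ∑ p : Fin n, |t p.castSucc - t p.succ| =
      2 * ∑ p : Fin n, max (t p.castSucc - t p.succ) 0 + (t (Fin.last n) - t 0) := by
    rw [← Fin.sum_succ_sub_castSucc t, Finset.mul_sum, ← Finset.sum_add_distrib]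
    refine Finset.sum_congr rfl fun p _ => ?_
    rcases le_total (t p.castSucc - t p.succ) 0 with h | h
    · rw [abs_of_nonpos h, max_eq_right h]; ring
    · rw [abs_of_nonneg h, max_eq_left h]; ring
  rw [Finset.sum_add_distrib]
  linarith

end IsUltra

/-! ### Transfer to executions and conclusion -/

theorem RequestSet.isUltra {V : Type*} {R : RequestSet V} {T : HST V} (h : R.AtLeaves T)
    (σ : Equiv.Perm (Fin (R.n + 1))) :
    IsUltra fun i j => T.dist (R.node (σ i)) (R.node (σ j)) where
  nonneg _ _ := T.dist_nonneg _ _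
  self _ := T.dist_self_of_isLeaf (h _)
  comm _ _ := T.dist_comm _ _
  le_max _ _ _ := T.dist_le_max_of_isLeaf (h _) (h _) (h _)

theorem QueueingOutcome.cost_le_mul_offlineCost {V : Type*} {T : HST V} {R : RequestSet V}
    (hleaf : R.AtLeaves T) (hcond : R.Condensed T) (E : QueueingOutcome R)
    (hlat : E.DistanceRespectingLatency T) (hord : E.DistanceRespectingOrder T)
    {σ : Equiv.Perm (Fin (R.n + 1))} (hσ : σ 0 = 0) :
    E.cost ≤ 18 * R.offlineCost T σ := by
  have hd := RequestSet.isUltra hleaf σ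
  let t : Fin (R.n + 1) → ℝ := fun i => R.time (σ i)
  -- The algorithm's order, with requests named by their positions in `σ`.
  let π : Equiv.Perm (Fin (R.n + 1)) := E.order.trans σ.symm
  have hπ : ∀ i, σ (π i) = E.order i := fun i => by simp [π]
  let x : Fin R.n → ℝ := fun i =>
    E.latency i + (R.time (E.order i.succ) - R.time (E.order i.castSucc))
  have h1 : ∑ i, x i ≤ 3 * ∑ p : Fin R.n, (T.dist (R.node (σ p.castSucc)) (R.node (σ p.succ)) +
      |t p.castSucc - t p.succ|) := by
    refine sum_le_mul_sum_of_card_le x _ three_pos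
      (fun p => add_nonneg (T.dist_nonneg _ _) (abs_nonneg _)) fun r hr => ?_
    refine hd.card_greedy_le t π ?_ x ?_ hr
    · intro i j hij
      simpa only [t, hπ] using hord i j hij
    · intro i j hij
      have := hlat i j (Fin.castSucc_lt_iff_succ_le.1 hij)
      simp only [t, hπ, x]
      rw [T.dist_comm]
      linarith
  have h2 := hd.sum_manhattan_le t
    (fun i => by simpa only [t, hσ, R.time_zero] using R.time_nonneg _) (by
      intro i j hij hk
      obtain ⟨a, b, ha, hb, hab⟩ := hcond (σ i) (σ j)
        ⟨hij, fun k => by simpa only [t, Equiv.apply_symm_apply] using hk (σ.symm k)⟩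
      exact ⟨σ.symm a, σ.symm b, by simpa [t] using ha, by simpa [t] using hb,
        by simpa [t] using hab⟩)
  -- The difference is the issue time of the last request in the order, since the dummy is issued at
  -- time `0`.
  have h3 : E.cost ≤ ∑ i, x i := by
    have := Fin.sum_succ_sub_castSucc fun i => R.time (E.order i)
    simp only [x, Finset.sum_add_distrib, E.order_zero, R.time_zero] at this ⊢
    rw [this, QueueingOutcome.cost]
    linarith [R.time_nonneg (E.order (Fin.last R.n))]
  have h4 : ∑ p : Fin R.n, max (T.dist (R.node (σ p.castSucc)) (R.node (σ p.succ)))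
      (t p.castSucc - t p.succ) = R.offlineCost T σ := rfl
  rw [h4] at h2
  linarith

theorem mainTheorem4 :
    ∃ C : ℝ, 0 < C ∧
      ∀ (V : Type*) (T : HST V) (A : QueueingAlgorithm V),
        A.HasDistanceRespectingLatency T → A.ProducesDistanceRespectingOrders T →
        ∀ R : RequestSet V, R.AtLeaves T → R.Condensed T →
          ∀ E ∈ A R, E.cost ≤ C * R.optCost T := by
  refine ⟨18, by norm_num, fun V T A hlat hord R hleaf hcond E hE => ?_⟩
  obtain ⟨σ, hσ, hopt⟩ := Finset.exists_mem_eq_inf' R.orders_nonempty (R.offlineCost T)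
  rw [RequestSet.optCost, hopt]
  exact E.cost_le_mul_offlineCost hleaf hcond (hlat R E hE) (hord R E hE)
    (by simpa [RequestSet.orders] using hσ)
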